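/- Let $k\ge 2$. For a finite group $G$, the $k$-dimensional Weisfeiler--Leman refinement (Version I) colors the $k$-tuples of elements of $G$ in rounds. In round $0$, the color $\chi^k_{G,0}(\bar g)$ of $\bar g=(g_1,\dots,g_k)$ records exactly for which indices $i,j$ one has $g_i=g_j$ and for which indices $i,j,m$ one has $g_ig_j=g_m$. In round $n+1$, $$\chi^k_{G,n+1}(\bar g)=\bigl(\chi^k_{G,n}(\bar g),\ \{\!\{(\chi^k_{G,n}(\bar g_{1\leftarrow x}),\dots,\chi^k_{G,n}(\bar g_{k\leftarrow x})) : x\in G\}\!\}\bigr),$$ where $\bar g_{j\leftarrow x}$ is obtained from $\bar g$ by replacing the $j$-th entry by $x$ and $\{\!\{\cdot\}\!\}$ denotes a multiset. For finite groups $G,H$ write $G\equiv^{\mathrm I}_k H$ if there is a bijection $f:G^k\to H^k$ such that $\chi^k_{G,n}(\bar g)=\chi^k_{H,n}(f(\bar g))$ for all $\bar g\in G^k$ and all rounds $n\ge 0$. Let $Z_0(G)=G$ and $Z_{i+1}(G)=[Z_i(G),G]$ denote the terms of the lower central series. **Lemma.** Let $k\ge 4$ and let $G,H$ be finite groups with $G\equiv^{\mathrm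 I}_k H$. Then for all $i\ge 0$: 1. $Z_i(G)/Z_{i+1}(G)\cong Z_i(H)/Z_{i+1}(H)$; 2. $Z_i(G)\equiv^{\mathrm I}_k Z_i(H)$; 3. $G/Z_i(G)\equiv^{\mathrm I}_k H/Z_i(H)$. In particular, either $G$ and $H$ are both nilpotent and have the same nilpotency class, or neither of them is nilpotent. -/

import Mathlib

/-- The multiset of all elements of a finite type, each with multiplicity one. -/
noncomputable def allElements (α : Type*) [Finite α] : Multiset α :=
  (Set.toFinite (Set.univ : Set α)).toFinset.val

/-- The colors that `k`-tuples can receive in round `n` of the Weisfeiler-Leman refinement, where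
group elements are colored by `C`. In round `0` a color records the colors of the entries, which
entries coincide, and which multiplication relations hold among the entries. A color of round
`n + 1` is a color of round `n` together with a multiset of `k`-tuples of colors of round `n`. -/
def WLColor (C : Type*) (k : ℕ) : ℕ → Type _
  | 0 => (Fin k → C) × (Fin k → Fin k → Prop) × (Fin k → Fin k → Fin k → Prop)
  | n + 1 => WLColor C k n × Multiset (Fin k → WLColor C k n)

/-- The coloring of `k`-tuples of elements of the finite group `G` with element coloring `γ`
computed by the first `n` rounds of the `k`-dimensional Weisfeiler-Leman algorithm, Version I. -/
noncomputable def wlColoring {G C : Type*} [Group G] [Finite G] (γ : G → C) (k : ℕ) :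
    (n : ℕ) → (Fin k → G) → WLColor C k n
  | 0 => fun g => (fun i => γ (g i), fun i j => g i = g j, fun i j m => g i * g j = g m)
  | n + 1 => fun g =>
      (wlColoring γ k n g,
        (allElements G).map fun x => fun j => wlColoring γ k n (Function.update g j x))

/-- Colored finite groups are not distinguished by `k`-dimensional Weisfeiler-Leman, Version I:
some bijection between the `k`-tuples preserves the colors of every round of the refinement (and
hence the stable colors). -/
def ColoredWLIndistinguishable {G H C : Type*} [Group G] [Finite G] [Group H] [Finite H]
    (k : ℕ) (γG : G → C) (γH : H → C) : Prop :=
  ∃ f : (Fin k → G) ≃ (Fin k → H), ∀ (n : ℕ) (g : Fin k → G),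
    wlColoring γG k n g = wlColoring γH k n (f g)

/-- Uncolored finite groups are not distinguished by `k`-dimensional Weisfeiler-Leman, Version I.
An uncolored group is one in which all elements have the same color. -/
def WLIndistinguishable (k : ℕ) (G H : Type*) [Group G] [Finite G] [Group H] [Finite H] : Prop :=
  ColoredWLIndistinguishable k (fun _ : G => ()) (fun _ : H => ())

/-- The term `Z_i(G)` of the lower central series: `Z_0(G) = G`, `Z_{i+1}(G) = [Z_i(G), G]`. -/
abbrev lowerCentralTerm (G : Type*) [Group G] (i : ℕ) : Subgroup G :=
  (⊤ : Subgroup G).lowerCentralSeries i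

/-! Equality of colors in all rounds (`WLRel`) is a back-and-forth relation between tuples:
`WLRel.exists_equiv` and `WLRel.of_backAndForth`. With `k ≥ 4` there are enough coordinates to track
products and commutators, so the lower central terms of the two groups correspond
(`WLPreserves.lowerCentralTerm`), and sets that correspond have equal size
(`WLIndistinguishable.card_eq`).

For subgroups the back-and-forth bijections restrict. For quotients, Hall's marriage theorem turns a
bijection of groups into one of cosets. The central factors are abelian, and a finite abelian group
is determined by its numbers of solutions of `x ^ d = 1`; these come from the sizes of the preserved
sets `{x ∈ K | x ^ d ∈ N}`. Nilpotency is read off from which terms have order one. -/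

/-! ### Finite abelian groups are determined by torsion counts. -/

section FiniteAbelian

theorem exists_equiv_comp_eq_of_card_fiber_eq {α β γ : Type*} [Finite α] [Finite β]
    (f : α → γ) (g : β → γ)
    (h : ∀ c, Nat.card {a // f a = c} = Nat.card {b // g b = c}) :
    ∃ e : α ≃ β, ∀ a, g (e a) = f a :=
  ⟨Equiv.ofFiberEquiv fun c => (Finite.card_eq.1 (h c)).some,
    fun a => Equiv.ofFiberEquiv_map _ a⟩

theorem nonempty_addEquiv_pi_subtype {ι : Type*} (M : ι → Type*) [∀ i, AddGroup (M i)]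
    (P : ι → Prop) (h : ∀ i, ¬ P i → Subsingleton (M i)) :
    Nonempty (((i : ι) → M i) ≃+ ((i : {i // P i}) → M i)) := by
  classical
  let f : ((i : ι) → M i) →+ ((i : {i // P i}) → M i) :=
    { toFun := fun x i => x i
      map_zero' := rfl
      map_add' := fun _ _ => rfl }
  refine ⟨AddEquiv.ofBijective f ⟨fun x y hxy => funext fun i => ?_, fun y => ?_⟩⟩
  · by_cases hi : P i
    · exact congrFun hxy ⟨i, hi⟩
    · have := h i hi
      exact Subsingleton.elim _ _
  · refine ⟨fun i => if hi : P i then y ⟨i, hi⟩ else 0, funext fun i => ?_⟩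
    exact dif_pos i.2

theorem AddCommGroup.exists_addEquiv_pi_zmod_isPrimePow (A : Type*) [AddCommGroup A] [Finite A] :
    ∃ (ι : Type) (_ : Fintype ι) (n : ι → ℕ), (∀ i, IsPrimePow (n i)) ∧
      Nonempty (A ≃+ ((i : ι) → ZMod (n i))) := by
  classical
  obtain ⟨ι, hι, p, hp, n, ⟨e⟩⟩ := AddCommGroup.equiv_directSum_zmod_of_finite A
  obtain ⟨e'⟩ := nonempty_addEquiv_pi_subtype (fun i => ZMod (p i ^ n i)) (fun i => n i ≠ 0)
    fun i hi => by
      rw [not_not.1 hi, pow_zero]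
      infer_instance
  exact ⟨{i : ι // n i ≠ 0}, inferInstance, fun i => p i ^ n i,
    fun i => (hp i).isPrimePow.pow i.2,
    ⟨e.trans ((DirectSum.addEquivProd fun i => ZMod (p i ^ n i)).trans e')⟩⟩

/-- The number of solutions of `d • x = 0` in a finite product of cyclic groups. -/
theorem card_nsmul_eq_zero_pi_zmod {ι : Type*} [Fintype ι] (n : ι → ℕ) (hn : ∀ i, n i ≠ 0)
    (d : ℕ) :
    Nat.card {x : (i : ι) → ZMod (n i) // d • x = 0} = ∏ i, (n i).gcd d := by
  have h : ∀ i, Nat.card {y : ZMod (n i) // d • y = 0} = (n i).gcd d := by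
    intro i
    have : NeZero (n i) := ⟨hn i⟩
    have := IsAddCyclic.card_nsmulAddMonoidHom_ker (ZMod (n i)) d
    rwa [Nat.card_zmod] at this
  simp_rw [← h]
  rw [← Nat.card_pi]
  exact Nat.card_congr ((Equiv.subtypeEquivRight fun x => funext_iff).trans
    (Equiv.subtypePiEquivPi (p := fun i (y : ZMod (n i)) => d • y = 0)))

theorem factorization_prod_gcd_prime_pow {ι : Type*} [Fintype ι] (n : ι → ℕ) (hn : ∀ i, n i ≠ 0)
    {p : ℕ} (hp : p.Prime) (j : ℕ) :
    (∏ i, (n i).gcd (p ^ j)).factorization p = ∑ i, min ((n i).factorization p) j := by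
  rw [Nat.factorization_prod fun i _ => Nat.gcd_ne_zero_left (hn i), Finsupp.finsetSum_apply]
  refine Finset.sum_congr rfl fun i _ => ?_
  rw [Nat.factorization_gcd (hn i) (pow_ne_zero _ hp.ne_zero), hp.factorization_pow]
  simp

theorem sum_min_succ {ι : Type*} [Fintype ι] (v : ι → ℕ) (j : ℕ) :
    ∑ i, min (v i) (j + 1) = ∑ i, min (v i) j + Nat.card {i // j < v i} := by
  classical
  rw [Nat.card_eq_fintype_card, Fintype.card_subtype, Finset.card_filter, ← Finset.sum_add_distrib]
  refine Finset.sum_congr rfl fun i _ => ?_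
  split_ifs <;> omega

theorem card_lt_eq_card_add_card_lt {ι : Type*} [Fintype ι] (v : ι → ℕ) (j : ℕ) :
    Nat.card {i // j < v i} = Nat.card {i // v i = j + 1} + Nat.card {i // j + 1 < v i} := by
  classical
  simp only [Nat.card_eq_fintype_card, Fintype.card_subtype, Finset.card_filter,
    ← Finset.sum_add_distrib]
  refine Finset.sum_congr rfl fun i _ => ?_
  split_ifs <;> omega

theorem IsPrimePow.eq_prime_pow_succ_iff {n p j : ℕ} (hn : IsPrimePow n) (hp : p.Prime) :
    n = p ^ (j + 1) ↔ n.factorization p = j + 1 := by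
  constructor
  · rintro rfl
    simp [hp.factorization_pow]
  · intro h
    obtain ⟨q, m, hq, -, rfl⟩ := (isPrimePow_nat_iff n).1 hn
    rw [hq.factorization_pow, Finsupp.single_apply] at h
    split_ifs at h with hqp
    · rw [hqp, h]

/-- Finite abelian groups in which `d • x = 0` has equally many solutions for every `d` are
isomorphic. -/
theorem AddCommGroup.nonempty_addEquiv_of_card_nsmul_eq_zero {A B : Type*} [AddCommGroup A]
    [Finite A] [AddCommGroup B] [Finite B]
    (h : ∀ d : ℕ, Nat.card {a : A // d • a = 0} = Nat.card {b : B // d • b = 0}) :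
    Nonempty (A ≃+ B) := by
  obtain ⟨ι, _, n, hn, ⟨eA⟩⟩ := AddCommGroup.exists_addEquiv_pi_zmod_isPrimePow A
  obtain ⟨κ, _, m, hm, ⟨eB⟩⟩ := AddCommGroup.exists_addEquiv_pi_zmod_isPrimePow B
  have h0 : ∀ d, ∏ i, (n i).gcd d = ∏ i, (m i).gcd d := by
    intro d
    rw [← card_nsmul_eq_zero_pi_zmod n fun i => (hn i).ne_zero,
      ← card_nsmul_eq_zero_pi_zmod m fun i => (hm i).ne_zero]
    refine Eq.trans (Nat.card_congr (eA.symm.toEquiv.subtypeEquiv fun x => ?_))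
      ((h d).trans (Nat.card_congr (eB.toEquiv.subtypeEquiv fun x => ?_)))
    · change d • x = 0 ↔ d • eA.symm x = 0
      rw [← map_nsmul, EmbeddingLike.map_eq_zero_iff]
    · change d • x = 0 ↔ d • eB x = 0
      rw [← map_nsmul, EmbeddingLike.map_eq_zero_iff]
  -- Compare `p`-adic valuations at `d = p ^ j`. First differences in `j` count the exponents above
  -- `j`; second differences count those equal to `j + 1`, hence the factors of order `p ^ (j + 1)`.
  have h1 : ∀ p : ℕ, p.Prime → ∀ j, ∑ i, min ((n i).factorization p) j =
      ∑ i, min ((m i).factorization p) j := by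
    intro p hp j
    rw [← factorization_prod_gcd_prime_pow n (fun i => (hn i).ne_zero) hp,
      ← factorization_prod_gcd_prime_pow m (fun i => (hm i).ne_zero) hp, h0]
  have h2 : ∀ p : ℕ, p.Prime → ∀ j, Nat.card {i // j < (n i).factorization p} =
      Nat.card {i // j < (m i).factorization p} := by
    intro p hp j
    have := h1 p hp (j + 1)
    rw [sum_min_succ, sum_min_succ, h1 p hp j] at this
    omega
  have h3 : ∀ c, Nat.card {i // n i = c} = Nat.card {i // m i = c} := by
    intro c
    by_cases hc : IsPrimePow c
    · obtain ⟨p, j, hp, hj, rfl⟩ := (isPrimePow_nat_iff c).1 hc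
      obtain ⟨j, rfl⟩ := Nat.exists_eq_succ_of_ne_zero hj.ne'
      have e1 := card_lt_eq_card_add_card_lt (fun i => (n i).factorization p) j
      have e2 := card_lt_eq_card_add_card_lt (fun i => (m i).factorization p) j
      rw [h2 p hp, h2 p hp] at e1
      simp only [Nat.succ_eq_add_one, (hn _).eq_prime_pow_succ_iff hp,
        (hm _).eq_prime_pow_succ_iff hp]
      omega
    · have : IsEmpty {i // n i = c} := ⟨fun i => hc (i.2 ▸ hn i)⟩
      have : IsEmpty {i // m i = c} := ⟨fun i => hc (i.2 ▸ hm i)⟩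
      simp
  obtain ⟨e, he⟩ := exists_equiv_comp_eq_of_card_fiber_eq n m h3
  have e' : ((i : ι) → ZMod (n i)) ≃+* ((i : κ) → ZMod (m i)) :=
    (RingEquiv.piCongrRight fun i => ZMod.ringEquivCongr (he i).symm).trans
      (RingEquiv.piCongrLeft (fun i => ZMod (m i)) e)
  exact ⟨eA.trans (e'.toAddEquiv.trans eB.symm)⟩

theorem CommGroup.nonempty_mulEquiv_of_card_pow_eq_one {A B : Type*} [CommGroup A] [Finite A]
    [CommGroup B] [Finite B]
    (h : ∀ d : ℕ, Nat.card {a : A // a ^ d = 1} = Nat.card {b : B // b ^ d = 1}) :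
    Nonempty (A ≃* B) :=
  (AddCommGroup.nonempty_addEquiv_of_card_nsmul_eq_zero (A := Additive A) (B := Additive B) h).map
    MulEquiv.toAdditive.symm

end FiniteAbelian

/-! ### Bijections from equal multisets and from Hall's theorem. -/

section Hall

theorem allElements_eq_univ_val (α : Type*) [Fintype α] :
    allElements α = (Finset.univ : Finset α).val := by
  simp [allElements]

theorem count_map_allElements {α γ : Type*} [Finite α] [DecidableEq γ] (f : α → γ) (c : γ) :
    ((allElements α).map f).count c = Nat.card {a // f a = c} := by
  have := Fintype.ofFinite α
  rw [Multiset.count_map, allElements_eq_univ_val, ← Finset.filter_val, ← Finset.card_def,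
    Nat.card_eq_fintype_card, Fintype.card_subtype]
  simp [eq_comm]

theorem exists_equiv_of_map_allElements_eq {α β γ : Type*} [Finite α] [Finite β]
    (f : α → γ) (g : β → γ) (h : (allElements α).map f = (allElements β).map g) :
    ∃ e : α ≃ β, ∀ a, g (e a) = f a := by
  classical
  refine exists_equiv_comp_eq_of_card_fiber_eq f g fun c => ?_
  rw [← count_map_allElements, h, count_map_allElements]

theorem map_allElements_equiv {α β : Type*} [Finite α] [Finite β] (e : α ≃ β) :
    (allElements α).map e = allElements β := by
  have := Fintype.ofFinite α
  have := Fintype.ofFinite β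
  rw [allElements_eq_univ_val, allElements_eq_univ_val, Multiset.map_univ_val_equiv]

theorem Nat.card_subtype_comp_mem {X X' : Type*} [Finite X] [Finite X'] (p : X → X') (c : ℕ)
    (hp : ∀ x', Nat.card {x // p x = x'} = c) (s : Set X') :
    Nat.card {x // p x ∈ s} = c * Nat.card s := by
  have := Fintype.ofFinite s
  rw [Nat.card_congr (show {x // p x ∈ s} ≃ Σ x' : s, {x // p x = x'} from
    { toFun := fun x => ⟨⟨p x, x.2⟩, ⟨x, rfl⟩⟩
      invFun := fun y => ⟨y.2.1, y.2.2.symm ▸ y.1.2⟩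
      left_inv := fun x => rfl
      right_inv := by
        rintro ⟨⟨x', hx'⟩, ⟨x, hx⟩⟩
        obtain rfl : p x = x' := hx
        rfl }), Nat.card_sigma]
  simp [hp, mul_comm]

/-- A bijection between the total spaces of two maps with fibers of the same constant size
contains a transversal bijection between the base spaces. -/
theorem exists_equiv_of_equiv_of_card_fiber {X X' Y Y' : Type*} [Finite X] [Finite Y] [Finite X']
    [Finite Y'] (σ : X ≃ Y) (p : X → X') (q : Y → Y') (c : ℕ) (hc : 0 < c)
    (hp : ∀ x', Nat.card {x // p x = x'} = c) (hq : ∀ y', Nat.card {y // q y = y'} = c) :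
    ∃ τ : X' ≃ Y', ∀ x', ∃ x, p x = x' ∧ q (σ x) = τ x' := by
  classical
  have := Fintype.ofFinite X'
  have := Fintype.ofFinite Y'
  have hcard : Nat.card X' = Nat.card Y' := by
    have h1 := Nat.card_subtype_comp_mem p c hp Set.univ
    have h2 := Nat.card_subtype_comp_mem q c hq Set.univ
    simp only [Set.mem_univ, Nat.card_univ] at h1 h2
    rw [Nat.card_congr (Equiv.subtypeUnivEquiv fun _ => trivial)] at h1 h2
    exact Nat.eq_of_mul_eq_mul_left hc (by rw [← h1, ← h2, Nat.card_congr σ])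
  -- Hall's condition: `σ` injects the `c * |A|` points over `A` into the `c * |B|` points over the
  -- set `B` of neighbors of `A`.
  obtain ⟨f, hf, hf'⟩ := (Fintype.all_card_le_filter_rel_iff_exists_injective
    (fun (x' : X') (y' : Y') => ∃ x, p x = x' ∧ q (σ x) = y')).1 (by
    intro A
    set B : Finset Y' := {b | ∃ a ∈ A, ∃ x, p x = a ∧ q (σ x) = b} with hB
    have h1 := Nat.card_subtype_comp_mem p c hp A
    have h2 := Nat.card_subtype_comp_mem q c hq B
    refine Nat.le_of_mul_le_mul_left ?_ hc
    simp only [SetLike.mem_coe, SetLike.coe_sort_coe, Nat.card_eq_fintype_card (α := A),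
      Nat.card_eq_fintype_card (α := B), Fintype.card_coe] at h1 h2
    rw [← h1, ← h2]
    refine Nat.card_le_card_of_injective
      (fun x => ⟨σ x.1, by simp only [hB, Finset.mem_filter_univ]; exact ⟨_, x.2, x.1, rfl, rfl⟩⟩)
      fun x y hxy => ?_
    exact Subtype.ext (σ.injective (congrArg Subtype.val hxy)))
  refine ⟨Equiv.ofBijective f ((Fintype.bijective_iff_injective_and_card f).2 ⟨hf, ?_⟩), hf'⟩
  simpa [Nat.card_eq_fintype_card] using hcard

end Hall

/-! ### Indistinguishable tuples and preserved sets. -/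

section WLRel

variable {G H : Type*} [Group G] [Finite G] [Group H] [Finite H] {k : ℕ}

/-- Tuples that receive the same color in every round of the refinement. -/
def WLRel (g : Fin k → G) (h : Fin k → H) : Prop :=
  ∀ n, wlColoring (fun _ : G => ()) k n g = wlColoring (fun _ : H => ()) k n h

theorem WLRel.symm {g : Fin k → G} {h : Fin k → H} (w : WLRel g h) : WLRel h g :=
  fun n => (w n).symm

theorem WLRel.eq_iff {g : Fin k → G} {h : Fin k → H} (w : WLRel g h) (i j : Fin k) :
    g i = g j ↔ h i = h j :=
  iff_of_eq (congrFun (congrFun (congrArg (fun c => c.2.1) (w 0)) i) j)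

theorem WLRel.mul_eq_iff {g : Fin k → G} {h : Fin k → H} (w : WLRel g h) (i j m : Fin k) :
    g i * g j = g m ↔ h i * h j = h m :=
  iff_of_eq (congrFun (congrFun (congrFun (congrArg (fun c => c.2.2) (w 0)) i) j) m)

theorem wlColoring_eq_of_le {C : Type*} {γG : G → C} {γH : H → C} {g : Fin k → G} {h : Fin k → H}
    {m n : ℕ} (hmn : m ≤ n) (w : wlColoring γG k n g = wlColoring γH k n h) :
    wlColoring γG k m g = wlColoring γH k m h := by
  induction n, hmn using Nat.le_induction with
  | base => exact w
  | succ n _ ih => exact ih (congrArg Prod.fst w)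

/-- Each round supplies its own bijection, but there are only finitely many bijections `G ≃ H`. If
each failed in some round, the one supplied by a round beyond all these failures would be
contradictory. -/
theorem WLRel.exists_equiv {g : Fin k → G} {h : Fin k → H} (w : WLRel g h) :
    ∃ σ : G ≃ H, ∀ x j, WLRel (Function.update g j x) (Function.update h j (σ x)) := by
  by_contra! hcon
  have key : ∀ σ : G ≃ H, ∃ n, ∃ x j,
      wlColoring (fun _ : G => ()) k n (Function.update g j x) ≠
        wlColoring (fun _ : H => ()) k n (Function.update h j (σ x)) := by
    intro σ
    obtain ⟨x, j, hx⟩ := hcon σ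
    obtain ⟨n, hn⟩ := not_forall.1 hx
    exact ⟨n, x, j, hn⟩
  choose N hN using key
  obtain ⟨B, hB⟩ := (Set.finite_range N).bddAbove
  obtain ⟨σ, hσ⟩ := exists_equiv_of_map_allElements_eq _ _ (congrArg Prod.snd (w (B + 1)))
  obtain ⟨x, j, hx⟩ := hN σ
  exact hx (wlColoring_eq_of_le (hB ⟨σ, rfl⟩) (congrFun (hσ x) j).symm)

theorem WLRel.of_backAndForth (R : (Fin k → G) → (Fin k → H) → Prop)
    (heq : ∀ g h, R g h → ∀ i j, g i = g j ↔ h i = h j)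
    (hmul : ∀ g h, R g h → ∀ i j m, g i * g j = g m ↔ h i * h j = h m)
    (hstep : ∀ g h, R g h →
      ∃ σ : G ≃ H, ∀ x j, R (Function.update g j x) (Function.update h j (σ x)))
    {g : Fin k → G} {h : Fin k → H} (hR : R g h) : WLRel g h := by
  intro n
  induction n generalizing g h with
  | zero =>
    refine Prod.ext rfl (Prod.ext ?_ ?_)
    · exact funext fun i => funext fun j => propext (heq g h hR i j)
    · exact funext fun i => funext fun j => funext fun m => propext (hmul g h hR i j m)
  | succ n ih =>
    refine Prod.ext (ih hR) ?_
    obtain ⟨σ, hσ⟩ := hstep g h hR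
    change (allElements G).map _ = (allElements H).map _
    rw [← map_allElements_equiv σ, Multiset.map_map]
    exact Multiset.map_congr rfl fun x _ => funext fun j => ih (hσ x j)

theorem WLRel.exists_update {g : Fin k → G} {h : Fin k → H} (w : WLRel g h) (x : G) :
    ∃ y : H, ∀ j, WLRel (Function.update g j x) (Function.update h j y) :=
  w.exists_equiv.elim fun σ hσ => ⟨σ x, hσ x⟩

theorem Fin.exists_ne_three (hk : 4 ≤ k) (a b c : Fin k) : ∃ d, d ≠ a ∧ d ≠ b ∧ d ≠ c := by
  have : ({a, b, c} : Finset (Fin k)).card < Fintype.card (Fin k) :=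
    Finset.card_le_three.trans_lt (by rw [Fintype.card_fin]; omega)
  obtain ⟨d, hd⟩ := Finset.exists_mem_notMem_of_card_lt_card (t := Finset.univ) this
  exact ⟨d, by simpa using hd⟩

/-- A spare coordinate `d` forces the answer to `g a * g b` to be `h a * h b`. As one answer serves
all coordinates, it may then be placed at `p`, even if `p` is `a` or `b`. -/
theorem WLRel.update_mul (hk : 4 ≤ k) {g : Fin k → G} {h : Fin k → H} (w : WLRel g h)
    (a b p : Fin k) :
    WLRel (Function.update g p (g a * g b)) (Function.update h p (h a * h b)) := by
  obtain ⟨d, hda, hdb, -⟩ := Fin.exists_ne_three hk a b b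
  obtain ⟨y, hy⟩ := w.exists_update (g a * g b)
  have := ((hy d).mul_eq_iff a b d).1 (by simp [hda.symm, hdb.symm])
  simp only [Function.update_of_ne hda.symm, Function.update_of_ne hdb.symm,
    Function.update_self] at this
  exact this ▸ hy p

theorem WLRel.update_inv_mul (hk : 4 ≤ k) {g : Fin k → G} {h : Fin k → H} (w : WLRel g h)
    (a b p : Fin k) :
    WLRel (Function.update g p ((g a)⁻¹ * g b)) (Function.update h p ((h a)⁻¹ * h b)) := by
  obtain ⟨d, hda, hdb, -⟩ := Fin.exists_ne_three hk a b b
  obtain ⟨y, hy⟩ := w.exists_update ((g a)⁻¹ * g b)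
  have := ((hy d).mul_eq_iff a d b).1 (by simp [hda.symm, hdb.symm])
  simp only [Function.update_of_ne hda.symm, Function.update_of_ne hdb.symm,
    Function.update_self] at this
  rw [← this, inv_mul_cancel_left]
  exact hy p

theorem WLRel.eq_one {g : Fin k → G} {h : Fin k → H} (w : WLRel g h) (j : Fin k) (hj : g j = 1) :
    h j = 1 := by
  simpa using (w.mul_eq_iff j j j).1 (by simp [hj])

theorem WLRel.update_pow (hk : 4 ≤ k) {g : Fin k → G} {h : Fin k → H} (w : WLRel g h)
    {a p : Fin k} (hap : a ≠ p) (n : ℕ) :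
    WLRel (Function.update g p (g a ^ n)) (Function.update h p (h a ^ n)) := by
  induction n with
  | zero =>
    simpa using w.update_inv_mul hk a a p
  | succ n ih =>
    simpa [hap, pow_succ] using ih.update_mul hk p a p

/-- Every entry in `A` of a tuple over `G` corresponds to an entry in `B` of each
indistinguishable tuple over `H`. -/
def WLPreserves (k : ℕ) (A : Set G) (B : Set H) : Prop :=
  ∀ (g : Fin k → G) (h : Fin k → H), WLRel g h → ∀ j, g j ∈ A → h j ∈ B

theorem WLPreserves.closure (hk : 4 ≤ k) {A : Set G} {B : Set H} (hAB : WLPreserves k A B) :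
    WLPreserves k (Subgroup.closure A : Set G) (Subgroup.closure B : Set H) := by
  -- The tuples stay universally quantified because the induction hypotheses are applied to updated
  -- tuples.
  suffices H : ∀ x ∈ Subgroup.closure A, ∀ (g : Fin k → G) (h : Fin k → H), WLRel g h →
      ∀ j, g j = x → h j ∈ Subgroup.closure B from fun g h w j hj => H _ hj g h w j rfl
  intro x hx
  induction hx using Subgroup.closure_induction with
  | mem x hx => exact fun g h w j hj => Subgroup.subset_closure (hAB g h w j (hj ▸ hx))
  | one => exact fun g h w j hj => (w.eq_one j hj).symm ▸ one_mem _
  | mul x y _ _ ihx ihy =>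
    intro g h w j hj
    obtain ⟨a, haj, -, -⟩ := Fin.exists_ne_three hk j j j
    obtain ⟨b, hbj, hba, -⟩ := Fin.exists_ne_three hk j a a
    obtain ⟨x', hx'⟩ := w.exists_update x
    obtain ⟨y', hy'⟩ := (hx' a).exists_update y
    have hm := ((hy' b).mul_eq_iff a b j).1 (by simp [haj.symm, hbj.symm, hba.symm, hj])
    have h1 := ihx _ _ (hx' a) a (by simp)
    have h2 := ihy _ _ (hy' b) b (by simp)
    simp only [Function.update_self, ne_eq, hba.symm, hbj.symm, haj.symm, not_false_eq_true,
      Function.update_of_ne] at hm h1 h2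
    exact hm ▸ mul_mem h1 h2
  | inv x _ ih =>
    intro g h w j hj
    obtain ⟨a, haj, -, -⟩ := Fin.exists_ne_three hk j j j
    obtain ⟨b, hbj, hba, -⟩ := Fin.exists_ne_three hk j a a
    obtain ⟨x', hx'⟩ := w.exists_update x
    have h1 := ih _ _ (hx' a) a (by simp)
    have h2 := ((hx' a).update_mul hk a j b).eq_one b (by simp [haj.symm, hj])
    simp only [Function.update_self, ne_eq, haj.symm, not_false_eq_true,
      Function.update_of_ne] at h1 h2
    rw [eq_inv_of_mul_eq_one_right h2]
    exact inv_mem h1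

/-- Four coordinates suffice: `j` holds the commutator, `a` and `b` hold `x` and `y`, `c` receives
`x * y`, and then `y * x` overwrites `b`. The relation to test is `⁅x, y⁆ * (y * x) = x * y`. -/
theorem WLPreserves.commutator (hk : 4 ≤ k) {K₁ K₂ : Subgroup G} {L₁ L₂ : Subgroup H}
    (h₁ : WLPreserves k (K₁ : Set G) (L₁ : Set H)) (h₂ : WLPreserves k (K₂ : Set G) (L₂ : Set H)) :
    WLPreserves k ((⁅K₁, K₂⁆ : Subgroup G) : Set G) ((⁅L₁, L₂⁆ : Subgroup H) : Set H) := by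
  refine WLPreserves.closure hk ?_
  rintro g h w j ⟨x, hx, y, hy, hxy⟩
  obtain ⟨a, haj, -, -⟩ := Fin.exists_ne_three hk j j j
  obtain ⟨b, hbj, hba, -⟩ := Fin.exists_ne_three hk j a a
  obtain ⟨c, hcj, hca, hcb⟩ := Fin.exists_ne_three hk j a b
  obtain ⟨x', hx'⟩ := w.exists_update x
  obtain ⟨y', hy'⟩ := (hx' a).exists_update y
  have h1 := h₁ _ _ (hx' a) a (by simpa using hx)
  have h2 := h₂ _ _ (hy' b) b (by simpa using hy)
  have h3 := (((hy' b).update_mul hk a b c).update_mul hk b a b).mul_eq_iff j b c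
  simp only [Function.update_self, ne_eq, haj.symm, hbj.symm, hcj.symm, hba.symm, hcb, hca.symm,
    hcb.symm, not_false_eq_true, Function.update_of_ne] at h1 h2 h3
  refine ⟨x', h1, y', h2, ?_⟩
  have h4 := h3.1 (by rw [← hxy, commutatorElement_def]; group)
  rw [commutatorElement_def, ← h4]
  group

theorem WLPreserves.lowerCentralTerm (hk : 4 ≤ k) (i : ℕ) :
    WLPreserves k (lowerCentralTerm G i : Set G) (lowerCentralTerm H i : Set H) := by
  induction i with
  | zero => exact fun _ _ _ _ _ => trivial
  | succ i ih => exact ih.commutator hk fun _ _ _ _ _ => Subgroup.mem_top _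

end WLRel

/-! ### Counting in quotients. -/

section Quotient

variable {G : Type*} [Group G] {k : ℕ}

theorem QuotientGroup.card_fiber_mk (N : Subgroup G) (c : G ⧸ N) :
    Nat.card {x : G // (x : G ⧸ N) = c} = Nat.card N := by
  exact (QuotientGroup.card_preimage_mk N {c}).trans (by simp)

theorem QuotientGroup.card_fiber_mk_comp (N : Subgroup G) (c : Fin k → G ⧸ N) :
    Nat.card {x : Fin k → G // (QuotientGroup.mk : G → G ⧸ N) ∘ x = c} = Nat.card N ^ k := by
  have e : {x : Fin k → G // (QuotientGroup.mk : G → G ⧸ N) ∘ x = c} ≃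
      ((i : Fin k) → {x : G // (x : G ⧸ N) = c i}) :=
    (Equiv.subtypeEquivRight fun x => funext_iff).trans
      (Equiv.subtypePiEquivPi (p := fun i (x : G) => (x : G ⧸ N) = c i))
  rw [Nat.card_congr e, Nat.card_pi]
  simp [QuotientGroup.card_fiber_mk]

/-- Moves a torsion count from the quotient to a subset of `G`, where preservation applies. -/
theorem card_mul_card_pow_eq_one_quotient {K N : Subgroup G} (hNK : N ≤ K)
    [(N.subgroupOf K).Normal] (d : ℕ) :
    Nat.card N * Nat.card {q : K ⧸ N.subgroupOf K // q ^ d = 1} =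
      Nat.card {x : G | x ∈ K ∧ x ^ d ∈ N} := by
  rw [← Nat.card_congr (Subgroup.subgroupOfEquivOfLe hNK).toEquiv]
  refine (QuotientGroup.card_preimage_mk (N.subgroupOf K) {q | q ^ d = 1}).symm.trans
    (Nat.card_congr ((Equiv.subtypeEquivRight fun x => ?_).trans
      (Equiv.subtypeSubtypeEquivSubtypeInter (· ∈ K) (fun x => x ^ d ∈ N))))
  change ((x : K ⧸ N.subgroupOf K)) ^ d = 1 ↔ _
  rw [← QuotientGroup.mk_pow, QuotientGroup.eq_one_iff, Subgroup.mem_subgroupOf,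
    Subgroup.coe_pow]

theorem quotient_mul_comm {K N : Subgroup G} [(N.subgroupOf K).Normal] (h : ⁅K, K⁆ ≤ N)
    (a b : K ⧸ N.subgroupOf K) : a * b = b * a := by
  induction a using QuotientGroup.induction_on with | H x =>
  induction b using QuotientGroup.induction_on with | H y =>
  rw [← QuotientGroup.mk_mul, ← QuotientGroup.mk_mul, QuotientGroup.eq, Subgroup.mem_subgroupOf]
  have := h (Subgroup.commutator_mem_commutator (inv_mem y.2) (inv_mem x.2))
  convert this using 1
  simp [commutatorElement_def, mul_assoc]

end Quotient

/-! ### Passing to subgroups, quotients and abelian sections. -/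

section Invariants

variable {G H : Type*} [Group G] [Finite G] [Group H] [Finite H] {k : ℕ}

theorem WLIndistinguishable.exists_equiv_pi_subtype (hGH : WLIndistinguishable k G H)
    {A : Set G} {B : Set H} (hAB : WLPreserves k A B) (hBA : WLPreserves k B A) :
    ∃ f : (Fin k → A) ≃ (Fin k → B),
      ∀ g, WLRel ((Subtype.val : A → G) ∘ g) ((Subtype.val : B → H) ∘ f g) := by
  obtain ⟨f, hf⟩ := hGH
  have w : ∀ g, WLRel g (f g) := fun g n => hf n g
  refine ⟨(Equiv.subtypePiEquivPi (p := fun _ x => x ∈ A)).symm.trans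
    ((f.subtypeEquiv fun g => ?_).trans (Equiv.subtypePiEquivPi (p := fun _ x => x ∈ B))),
    fun g => w _⟩
  exact ⟨fun hg i => hAB _ _ (w g) i (hg i), fun hg i => hBA _ _ (w g).symm i (hg i)⟩

/-- The bijection of `k`-tuples restricts to `A ^ k ≃ B ^ k`, and taking `k`-th powers is injective
for `k ≠ 0`. -/
theorem WLIndistinguishable.card_eq (hk : k ≠ 0) (hGH : WLIndistinguishable k G H)
    {A : Set G} {B : Set H} (hAB : WLPreserves k A B) (hBA : WLPreserves k B A) :
    Nat.card A = Nat.card B := by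
  obtain ⟨f, -⟩ := hGH.exists_equiv_pi_subtype hAB hBA
  have := Nat.card_congr f
  rw [Nat.card_fun, Nat.card_fun, Nat.card_fin] at this
  exact Nat.pow_left_injective hk this

theorem WLIndistinguishable.subgroup (hk : k ≠ 0) (hGH : WLIndistinguishable k G H)
    {K : Subgroup G} {L : Subgroup H} (hKL : WLPreserves k (K : Set G) (L : Set H))
    (hLK : WLPreserves k (L : Set H) (K : Set G)) : WLIndistinguishable k K L := by
  obtain ⟨f, hf⟩ := hGH.exists_equiv_pi_subtype hKL hLK
  refine ⟨f, fun n g => ?_⟩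
  refine WLRel.of_backAndForth (G := K) (H := L)
    (fun g h => WLRel ((Subtype.val : K → G) ∘ g) ((Subtype.val : L → H) ∘ h)) ?_ ?_ ?_ (hf g) n
  · exact fun g h w i j => Subtype.ext_iff.trans ((w.eq_iff i j).trans Subtype.ext_iff.symm)
  · exact fun g h w i j m => Subtype.ext_iff.trans ((w.mul_eq_iff i j m).trans
      (Subtype.ext_iff (a1 := h i * h j)).symm)
  · intro g h w
    obtain ⟨σ, hσ⟩ := w.exists_equiv
    let j : Fin k := ⟨0, Nat.pos_of_ne_zero hk⟩
    refine ⟨σ.subtypeEquiv fun x => ?_, fun x j => ?_⟩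
    · exact ⟨fun hx => by simpa using hKL _ _ (hσ x j) j (by simpa using hx),
        fun hx => by simpa using hLK _ _ (hσ x j).symm j (by simpa using hx)⟩
    · rw [Function.comp_update, Function.comp_update]
      exact hσ x j

theorem WLRel.mk_eq_of_mk_eq (hk : 4 ≤ k) {N : Subgroup G} {M : Subgroup H}
    (hNM : WLPreserves k (N : Set G) (M : Set H)) {g : Fin k → G} {h : Fin k → H}
    (w : WLRel g h) (i j : Fin k) (hij : (g i : G ⧸ N) = g j) : (h i : H ⧸ M) = h j := by
  rw [QuotientGroup.eq] at hij ⊢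
  simpa using hNM _ _ (w.update_inv_mul hk i j i) i (by simpa using hij)

theorem WLRel.mk_mul_eq_of_mk_mul_eq (hk : 4 ≤ k) {N : Subgroup G} {M : Subgroup H}
    (hNM : WLPreserves k (N : Set G) (M : Set H)) {g : Fin k → G} {h : Fin k → H}
    (w : WLRel g h) (i j m : Fin k) (hij : ((g i * g j : G) : G ⧸ N) = g m) :
    ((h i * h j : H) : H ⧸ M) = h m := by
  obtain ⟨p, hp, -, -⟩ := Fin.exists_ne_three hk m m m
  simpa [hp.symm] using
    (w.update_mul hk i j p).mk_eq_of_mk_eq hk hNM p m (by simpa [hp.symm] using hij)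

theorem WLIndistinguishable.quotient (hk : 4 ≤ k) (hGH : WLIndistinguishable k G H)
    (N : Subgroup G) (M : Subgroup H) [N.Normal] [M.Normal]
    (hNM : WLPreserves k (N : Set G) (M : Set H)) (hMN : WLPreserves k (M : Set H) (N : Set G)) :
    WLIndistinguishable k (G ⧸ N) (H ⧸ M) := by
  have hcard : Nat.card N = Nat.card M := hGH.card_eq (by omega) hNM hMN
  have hrel : ∀ {g : Fin k → G} {h : Fin k → H}, WLRel g h →
      WLRel ((QuotientGroup.mk : G → G ⧸ N) ∘ g) ((QuotientGroup.mk : H → H ⧸ M) ∘ h) := by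
    intro g₀ h₀ w₀
    -- Tuples of cosets are related when they have indistinguishable lifts.
    refine WLRel.of_backAndForth (fun a b => ∃ (g : Fin k → G) (h : Fin k → H), WLRel g h ∧
      (QuotientGroup.mk : G → G ⧸ N) ∘ g = a ∧ (QuotientGroup.mk : H → H ⧸ M) ∘ h = b)
      ?_ ?_ ?_ ⟨g₀, h₀, w₀, rfl, rfl⟩
    · rintro _ _ ⟨g, h, w, rfl, rfl⟩ i j
      exact ⟨w.mk_eq_of_mk_eq hk hNM i j, w.symm.mk_eq_of_mk_eq hk hMN i j⟩
    · rintro _ _ ⟨g, h, w, rfl, rfl⟩ i j m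
      exact ⟨w.mk_mul_eq_of_mk_mul_eq hk hNM i j m, w.symm.mk_mul_eq_of_mk_mul_eq hk hMN i j m⟩
    · rintro _ _ ⟨g, h, w, rfl, rfl⟩
      obtain ⟨σ, hσ⟩ := w.exists_equiv
      -- All cosets on both sides have the same size, so `τ` can be chosen such that every coset `x`
      -- has a representative that `σ` sends into `τ x`.
      obtain ⟨τ, hτ⟩ := exists_equiv_of_equiv_of_card_fiber σ (QuotientGroup.mk : G → G ⧸ N)
        (QuotientGroup.mk : H → H ⧸ M) (Nat.card N) Nat.card_pos
        (QuotientGroup.card_fiber_mk N) (by rw [hcard]; exact QuotientGroup.card_fiber_mk M)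
      refine ⟨τ, fun x j => ?_⟩
      obtain ⟨y, rfl, hy⟩ := hτ x
      exact ⟨_, _, hσ y j, Function.comp_update .., by rw [Function.comp_update, hy]⟩
  obtain ⟨f, hf⟩ := hGH
  obtain ⟨τ, hτ⟩ := exists_equiv_of_equiv_of_card_fiber f ((QuotientGroup.mk : G → G ⧸ N) ∘ ·)
    ((QuotientGroup.mk : H → H ⧸ M) ∘ ·) (Nat.card N ^ k) (pow_pos Nat.card_pos k)
    (QuotientGroup.card_fiber_mk_comp N)
    (by rw [hcard]; exact QuotientGroup.card_fiber_mk_comp M)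
  refine ⟨τ, fun n a => ?_⟩
  obtain ⟨g, rfl, hg⟩ := hτ a
  exact hg ▸ hrel (fun n => hf n g) n

theorem WLPreserves.setOf_pow_mem (hk : 4 ≤ k) {K N : Subgroup G} {L M : Subgroup H}
    (hKL : WLPreserves k (K : Set G) (L : Set H)) (hNM : WLPreserves k (N : Set G) (M : Set H))
    (d : ℕ) : WLPreserves k {x : G | x ∈ K ∧ x ^ d ∈ N} {x : H | x ∈ L ∧ x ^ d ∈ M} := by
  rintro g h w j ⟨h1, h2⟩
  obtain ⟨p, hp, -, -⟩ := Fin.exists_ne_three hk j j j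
  exact ⟨hKL g h w j h1, by simpa using hNM _ _ (w.update_pow hk hp.symm d) p (by simpa using h2)⟩

theorem WLIndistinguishable.nonempty_mulEquiv_quotient (hk : 4 ≤ k)
    (hGH : WLIndistinguishable k G H) {K N : Subgroup G} {L M : Subgroup H}
    [(N.subgroupOf K).Normal] [(M.subgroupOf L).Normal] (hNK : N ≤ K) (hML : M ≤ L)
    (hK : ⁅K, K⁆ ≤ N) (hL : ⁅L, L⁆ ≤ M)
    (hKL : WLPreserves k (K : Set G) (L : Set H)) (hLK : WLPreserves k (L : Set H) (K : Set G))
    (hNM : WLPreserves k (N : Set G) (M : Set H)) (hMN : WLPreserves k (M : Set H) (N : Set G)) :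
    Nonempty ((K ⧸ N.subgroupOf K) ≃* (L ⧸ M.subgroupOf L)) := by
  let : CommGroup (K ⧸ N.subgroupOf K) :=
    { QuotientGroup.Quotient.group (N.subgroupOf K) with mul_comm := quotient_mul_comm hK }
  let : CommGroup (L ⧸ M.subgroupOf L) :=
    { QuotientGroup.Quotient.group (M.subgroupOf L) with mul_comm := quotient_mul_comm hL }
  refine CommGroup.nonempty_mulEquiv_of_card_pow_eq_one fun d => ?_
  have hk0 : k ≠ 0 := by omega
  have h1 : Nat.card N = Nat.card M := hGH.card_eq hk0 hNM hMN
  have h2 := hGH.card_eq hk0 (hKL.setOf_pow_mem hk hNM d) (hLK.setOf_pow_mem hk hMN d)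
  rw [← card_mul_card_pow_eq_one_quotient hNK, ← card_mul_card_pow_eq_one_quotient hML, h1] at h2
  exact Nat.eq_of_mul_eq_mul_left Nat.card_pos h2

end Invariants

/-! ### Application to the lower central series. -/

theorem mainTheorem7 {G H : Type*} [Group G] [Finite G] [Group H] [Finite H]
    (k : ℕ) (hk : 4 ≤ k) (hGH : WLIndistinguishable k G H) :
    (∀ i : ℕ,
      Nonempty
        ((lowerCentralTerm G i ⧸ (lowerCentralTerm G (i + 1)).subgroupOf (lowerCentralTerm G i)) ≃*
          (lowerCentralTerm H i ⧸
            (lowerCentralTerm H (i + 1)).subgroupOf (lowerCentralTerm H i))) ∧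
      WLIndistinguishable k (lowerCentralTerm G i) (lowerCentralTerm H i) ∧
      WLIndistinguishable k (G ⧸ lowerCentralTerm G i) (H ⧸ lowerCentralTerm H i)) ∧
    ((Group.IsNilpotent G ∧ Group.IsNilpotent H ∧
        Group.nilpotencyClass G = Group.nilpotencyClass H) ∨
      (¬ Group.IsNilpotent G ∧ ¬ Group.IsNilpotent H)) := by
  have hp := fun i => WLPreserves.lowerCentralTerm (G := G) (H := H) hk i
  have hp' := fun i => WLPreserves.lowerCentralTerm (G := H) (H := G) hk i
  refine ⟨fun i => ⟨?_, hGH.subgroup (by omega) (hp i) (hp' i), hGH.quotient hk _ _ (hp i) (hp' i)⟩, ?_⟩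
  · exact hGH.nonempty_mulEquiv_quotient hk
      ((⊤ : Subgroup G).lowerCentralSeries_antitone i.le_succ)
      ((⊤ : Subgroup H).lowerCentralSeries_antitone i.le_succ)
      (Subgroup.commutator_mono le_rfl le_top) (Subgroup.commutator_mono le_rfl le_top)
      (hp i) (hp' i) (hp (i + 1)) (hp' (i + 1))
  · have hbot : ∀ i, lowerCentralTerm G i = ⊥ ↔ lowerCentralTerm H i = ⊥ := by
      intro i
      rw [← Subgroup.card_eq_one, ← Subgroup.card_eq_one]
      exact Eq.congr_left (hGH.card_eq (by omega) (hp i) (hp' i))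
    have hnil : Group.IsNilpotent G ↔ Group.IsNilpotent H := by
      rw [Subgroup.nilpotent_iff_lowerCentralSeries, Subgroup.nilpotent_iff_lowerCentralSeries]
      exact exists_congr hbot
    by_cases hG : Group.IsNilpotent G
    · have hH := hnil.1 hG
      refine Or.inl ⟨hG, hH, eq_of_forall_ge_iff fun n => ?_⟩
      rw [← Subgroup.lowerCentralSeries_eq_bot_iff_nilpotencyClass_le,
        ← Subgroup.lowerCentralSeries_eq_bot_iff_nilpotencyClass_le]
      exact hbot n
    · exact Or.inr ⟨hG, fun hH => hG (hnil.2 hH)⟩
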